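/- Fix a natural number $d\ge 2$. Let $\Sigma^d$ be the class of finite (abstract) simplicial complexes $K$ in which every vertex is contained in at most $d$ edges; $V(K)$ denotes the vertex set of $K$, and distances between vertices are shortest-path distances in the $1$-skeleton. For $r\ge 1$ let $Z^{r,d}$ be the set of rooted isomorphism classes of rooted $r$-balls, i.e. of complexes $L\in\Sigma^d$ with a distinguished vertex $x$ such that every vertex of $L$ is at distance at most $r$ from $x$. For $K\in\Sigma^d$ and $p\in V(K)$ let $B_r(p)$ be the complex of all simplices of $K$ all of whose vertices are at distance at most $r$ from $p$, rooted at $p$, and for $\alpha\in Z^{r,d}$ put $$p_K(\alpha)=\frac{|\{p\in V(K): B_r(p)\cong\alpha\}|}{|V(K)|}.$$ A sequence $(K^n)_{n\ge1}$ in $\Sigma^d$ is called convergent if $|V(K^n)|\to\infty$ and $\lim_{n\to\infty}p_{K^n}(\alpha)$ exists for all $r\ge1$ and $\alpha\in Z^{r,d}$. Given an enumeration $\alpha_1,\alpha_2,\dots$ of all elements of the disjoint union of the sets $Z^{r,d}$, $r\ge1$, let $$d_s(K,L)=\sum_{j=1}^\infty 2^{-j}\,|p_K(\alpha_j)-p_L(\alpha_j)|.$$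 Let $b^i(K)=\dim\operatorname{Ker} d_i-\dim\operatorname{Im} d_{i-1}$ be the real Betti numbers of $K$, where $d_q:C^q(K)\to C^{q+1}(K)$ are the simplicial coboundary operators on real cochains. (1) If $(K^n)_{n\ge 1}\subset\Sigma^d$ is convergent, then $\lim_{n\to\infty} b^i(K^n)/|V(K^n)|$ exists for every $i\ge1$. (2) For every such enumeration and every $\varepsilon>0$ there is $\delta>0$ such that for all nonempty $K,L\in\Sigma^d$ with $d_s(K,L)<\delta$, $$\left|\frac{b^i(K)}{|V(K)|}-\frac{b^i(L)}{|V(L)|}\right|\le\varepsilon\quad\text{for every } i\ge1.$$ -/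

import Mathlib

open Filter Topology

universe u v

namespace BoundedComplex

/-! Abstract simplicial complexes are Mathlib's `AbstractSimplicialComplex V`: the vertex set is all
of `V`, and the faces are the nonempty finite vertex sets of the simplices.  The complex is finite
when `V` is finite. -/

section Skeleton

variable {V : Type u}

open Classical in
/-- The 1-skeleton of `K`: its vertices are those of `K`, its edges the 1-simplices of `K`. -/
def skeleton (K : AbstractSimplicialComplex V) : SimpleGraph V where
  Adj x y := x ≠ y ∧ ({x, y} : Finset V) ∈ K.faces
  symm := ⟨fun x y h => ⟨h.1.symm, by rw [Finset.pair_comm]; exact h.2⟩⟩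
  loopless := ⟨fun _ h => h.1 rfl⟩

/-- Vertex degree bound `d`: every vertex lies in at most `d` edges. -/
def DegreeLE (d : ℕ) (K : AbstractSimplicialComplex V) : Prop :=
  ∀ x : V, ((skeleton K).neighborSet x).encard ≤ d

/-- The vertices at distance at most `r` from `p` in the 1-skeleton (vertices in other connected
components have distance `⊤`). -/
def ballVertices (K : AbstractSimplicialComplex V) (r : ℕ) (p : V) : Set V :=
  {x | (skeleton K).edist p x ≤ r}

theorem center_mem_ballVertices (K : AbstractSimplicialComplex V) (r : ℕ) (p : V) :
    p ∈ ballVertices K r p := by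
  simp [ballVertices]

/-- `B_r(p)`: the complex of all simplices of `K` all of whose vertices are at distance at most `r`
from `p`. -/
def ball (K : AbstractSimplicialComplex V) (r : ℕ) (p : V) :
    AbstractSimplicialComplex (ballVertices K r p) where
  faces := {s | s.map (Function.Embedding.subtype _) ∈ K.faces}
  isRelLowerSet_faces := by
    intro s hs
    refine ⟨Finset.map_nonempty.1 (K.isRelLowerSet_faces hs).1, fun t hts ht => ?_⟩
    exact (K.isRelLowerSet_faces hs).2 (Finset.map_subset_map.2 hts) (Finset.map_nonempty.2 ht)
  singleton_mem x := by
    simpa using K.singleton_mem (x : V)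

/-- The root of `B_r(p)`. -/
def ballRoot (K : AbstractSimplicialComplex V) (r : ℕ) (p : V) : ballVertices K r p :=
  ⟨p, center_mem_ballVertices K r p⟩

end Skeleton

/-- Rooted isomorphism: a bijection of the vertices which maps root to root and under which the
simplices correspond to each other. -/
def RootedIso {V : Type u} {W : Type v} (K : AbstractSimplicialComplex V) (x : V)
    (L : AbstractSimplicialComplex W) (y : W) : Prop :=
  ∃ e : V ≃ W, e x = y ∧ ∀ s : Finset V, s ∈ K.faces ↔ s.map e.toEmbedding ∈ L.faces

theorem RootedIso.refl {V : Type u} (K : AbstractSimplicialComplex V) (x : V) :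
    RootedIso K x K x :=
  ⟨Equiv.refl V, rfl, fun s => by simp⟩

theorem RootedIso.symm {V : Type u} {W : Type v} {K : AbstractSimplicialComplex V} {x : V}
    {L : AbstractSimplicialComplex W} {y : W} (h : RootedIso K x L y) : RootedIso L y K x := by
  obtain ⟨e, he, hs⟩ := h
  refine ⟨e.symm, by simp [← he], fun s => ?_⟩
  rw [hs, Finset.map_map]
  simp

theorem RootedIso.trans {V : Type u} {W : Type v} {X : Type*} {K : AbstractSimplicialComplex V}
    {x : V} {L : AbstractSimplicialComplex W} {y : W} {M : AbstractSimplicialComplex X} {z : X}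
    (h : RootedIso K x L y) (h' : RootedIso L y M z) : RootedIso K x M z := by
  obtain ⟨e, he, hs⟩ := h
  obtain ⟨f, hf, ht⟩ := h'
  refine ⟨e.trans f, by simp [he, hf], fun s => ?_⟩
  rw [hs, ht, Finset.map_map, Equiv.trans_toEmbedding]

/-- A rooted `r`-ball of degree bound `d`: a finite complex of vertex degree bound `d` with a
distinguished vertex from which every vertex has distance at most `r`.  As rooted balls are
considered up to isomorphism only, the vertex set is taken to be `Fin n`. -/
structure RootedBall (r d : ℕ) where
  /-- the number of vertices -/
  n : ℕ
  /-- the complex -/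
  complex : AbstractSimplicialComplex (Fin n)
  /-- the root -/
  root : Fin n
  degreeLE : DegreeLE d complex
  edist_le : ∀ y : Fin n, (skeleton complex).edist root y ≤ r

/-- Rooted isomorphism as an equivalence relation on rooted `r`-balls. -/
instance rootedBallSetoid (r d : ℕ) : Setoid (RootedBall r d) where
  r A B := RootedIso A.complex A.root B.complex B.root
  iseqv := ⟨fun _ => RootedIso.refl _ _, RootedIso.symm, RootedIso.trans⟩

/-- `Z^{r,d}`: the rooted isomorphism classes of rooted `r`-balls of degree bound `d`. -/
def BallClass (r d : ℕ) : Type :=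
  Quotient (rootedBallSetoid r d)

/-- All the `r`-ball classes of degree bound `d`, for all `r ≥ 1`. -/
def AllBalls (d : ℕ) : Type :=
  Σ r : {r : ℕ // 1 ≤ r}, BallClass r d

section Sampling

variable {V : Type u}

/-- `T(K, α)`: the vertices `p` such that `B_r(p)` belongs to the isomorphism class `α`. -/
def verticesOfType (K : AbstractSimplicialComplex V) {r d : ℕ} (α : BallClass r d) : Set V :=
  {p | ∃ A : RootedBall r d, Quotient.mk _ A = α ∧
    RootedIso (ball K r p) (ballRoot K r p) A.complex A.root}

/-- The sampling probability `p_K(α) = |T(K, α)| / |K_0|`. -/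
noncomputable def samplingProb (K : AbstractSimplicialComplex V) {r d : ℕ} (α : BallClass r d) :
    ℝ :=
  ((verticesOfType K α).ncard : ℝ) / (Nat.card V : ℝ)

/-- The sampling pseudo-metric `d_s` with respect to an enumeration of all the `r`-balls, `r ≥ 1`
(starting at `0`, so that the weights `1/2, 1/4, …` are `1 / 2 ^ (k + 1)`). -/
noncomputable def samplingDist {d : ℕ} (enum : ℕ ≃ AllBalls d) {W : Type v}
    (K : AbstractSimplicialComplex V) (L : AbstractSimplicialComplex W) : ℝ :=
  ∑' k : ℕ, 1 / 2 ^ (k + 1) * |samplingProb K (enum k).2 - samplingProb L (enum k).2|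

/-- A sequence of finite complexes is convergent (with degree bound `d`) if the number of vertices
tends to infinity and all the sampling probabilities converge. -/
def IsConvergent (d : ℕ) {V : ℕ → Type u} (K : ∀ n, AbstractSimplicialComplex (V n)) : Prop :=
  Tendsto (fun n => Nat.card (V n)) atTop atTop ∧
    ∀ r : ℕ, 1 ≤ r → ∀ α : BallClass r d,
      ∃ l : ℝ, Tendsto (fun n => samplingProb (K n) α) atTop (𝓝 l)

end Sampling

section Cohomology

variable {V : Type u}

/-- `a = (a_0, …, a_q)` is an ordered `q`-simplex of `K`: its entries are distinct and they are the
vertices of a simplex of `K`. -/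
def IsOrderedSimplex (K : AbstractSimplicialComplex V) {q : ℕ} (a : Fin (q + 1) → V) : Prop :=
  ∃ h : Function.Injective a, Finset.univ.map ⟨a, h⟩ ∈ K.faces

theorem IsOrderedSimplex.comp_perm {K : AbstractSimplicialComplex V} {q : ℕ}
    {a : Fin (q + 1) → V} (h : IsOrderedSimplex K a) (π : Equiv.Perm (Fin (q + 1))) :
    IsOrderedSimplex K (a ∘ π) := by
  obtain ⟨h, ha⟩ := h
  refine ⟨h.comp π.injective, ?_⟩
  convert ha using 1
  ext x
  simp only [Finset.mem_map, Finset.mem_univ, true_and, Function.Embedding.coeFn_mk,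
    Function.comp_apply]
  exact ⟨fun ⟨i, hi⟩ => ⟨π i, hi⟩, fun ⟨i, hi⟩ => ⟨π.symm i, by simpa using hi⟩⟩

theorem isOrderedSimplex_comp_perm_iff {K : AbstractSimplicialComplex V} {q : ℕ}
    {a : Fin (q + 1) → V} (π : Equiv.Perm (Fin (q + 1))) :
    IsOrderedSimplex K (a ∘ π) ↔ IsOrderedSimplex K a := by
  refine ⟨fun h => ?_, fun h => h.comp_perm π⟩
  have := h.comp_perm π.symm
  rwa [Function.comp_assoc, Equiv.self_comp_symm, Function.comp_id] at this

/-- `C^q(K)`: the real `q`-cochains, that is the real functions on oriented `q`-simplices.  They are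
written without choosing orientations, as the alternating functions of ordered `q`-simplices
(extended by `0` to all tuples); once an orientation is chosen for every `q`-simplex, such a
function amounts to an arbitrary real function on the set of `q`-simplices. -/
def cochains (K : AbstractSimplicialComplex V) (q : ℕ) :
    Submodule ℝ ((Fin (q + 1) → V) → ℝ) where
  carrier := {f | (∀ a, ¬ IsOrderedSimplex K a → f a = 0) ∧
    ∀ (π : Equiv.Perm (Fin (q + 1))) (a : Fin (q + 1) → V),
      f (a ∘ π) = ((Equiv.Perm.sign π : ℤ) : ℝ) * f a}
  zero_mem' := by simp
  add_mem' := by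
    rintro f g ⟨hf, hf'⟩ ⟨hg, hg'⟩
    exact ⟨fun a ha => by simp [hf a ha, hg a ha],
      fun π a => by simp only [Pi.add_apply, hf' π a, hg' π a]; ring⟩
  smul_mem' := by
    rintro c f ⟨hf, hf'⟩
    exact ⟨fun a ha => by simp [hf a ha],
      fun π a => by simp only [Pi.smul_apply, smul_eq_mul, hf' π a]; ring⟩

open Classical in
/-- The value of the coboundary of `f` at `(a_0, …, a_{q+1})`: the alternating sum
`∑ j, (-1)^j f(a_0, …, a_{j-1}, a_{j+1}, …, a_{q+1})` if `(a_0, …, a_{q+1})` is an ordered simplex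
of `K`, and `0` otherwise. -/
noncomputable def coboundaryFun (K : AbstractSimplicialComplex V) (q : ℕ)
    (f : (Fin (q + 1) → V) → ℝ) (a : Fin (q + 2) → V) : ℝ :=
  if IsOrderedSimplex K a then
    ∑ j : Fin (q + 2), (-1 : ℝ) ^ (j : ℕ) * f (fun k => a (j.succAbove k))
  else 0

/-- Omitting the `j`-th entry after a permutation `π` is the same as omitting the `π j`-th entry
first and permuting afterwards, with the expected sign. -/
theorem exists_perm_succAbove {n : ℕ} (π : Equiv.Perm (Fin (n + 1))) (j : Fin (n + 1)) :
    ∃ ρ : Equiv.Perm (Fin n),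
      (∀ k, π (j.succAbove k) = (π j).succAbove (ρ k)) ∧
      (-1 : ℤ) ^ (j : ℕ) * (Equiv.Perm.sign ρ : ℤ) =
        (Equiv.Perm.sign π : ℤ) * (-1) ^ ((π j : Fin (n + 1)) : ℕ) := by
  obtain ⟨⟨p, ρ⟩, hρ⟩ := Equiv.Perm.decomposeFin.symm.surjective
    (j.cycleRange.symm.trans (π.trans (π j).cycleRange))
  have h0 : p = 0 := by
    have := congrArg (fun e : Equiv.Perm (Fin (n + 1)) => e 0) hρ
    simpa [Equiv.Perm.decomposeFin_symm_apply_zero, Fin.cycleRange_symm_zero] using this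
  subst h0
  refine ⟨ρ, fun k => ?_, ?_⟩
  · have := congrArg (fun e : Equiv.Perm (Fin (n + 1)) => e k.succ) hρ
    simp only [Equiv.Perm.decomposeFin_symm_apply_succ, Equiv.swap_self, Equiv.refl_apply,
      Equiv.trans_apply, Fin.cycleRange_symm_succ] at this
    rw [← Fin.cycleRange_symm_succ (π j), this, Equiv.symm_apply_apply]
  · have := congrArg Equiv.Perm.sign hρ
    simp only [Equiv.Perm.decomposeFin.symm_sign, if_true, one_mul, Equiv.Perm.sign_trans,
      Equiv.Perm.sign_symm, Fin.sign_cycleRange] at this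
    rw [this]
    push_cast
    have h1 : (-1 : ℤ) ^ (j : ℕ) * (-1) ^ (j : ℕ) = 1 := by
      rw [← mul_pow]; simp
    linear_combination ((-1 : ℤ) ^ ((π j : Fin (n + 1)) : ℕ) * (Equiv.Perm.sign π : ℤ)) * h1

theorem coboundaryFun_mem (K : AbstractSimplicialComplex V) (q : ℕ)
    {f : (Fin (q + 1) → V) → ℝ} (hf : f ∈ cochains K q) :
    coboundaryFun K q f ∈ cochains K (q + 1) := by
  refine ⟨fun a ha => if_neg ha, fun π a => ?_⟩
  by_cases ha : IsOrderedSimplex K a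
  · rw [coboundaryFun, coboundaryFun, if_pos ha, if_pos (ha.comp_perm π), Finset.mul_sum,
      ← Equiv.sum_comp π (fun j => ((Equiv.Perm.sign π : ℤ) : ℝ) *
        ((-1 : ℝ) ^ (j : ℕ) * f (fun k => a (j.succAbove k))))]
    refine Finset.sum_congr rfl fun j _ => ?_
    obtain ⟨ρ, hρ, hs⟩ := exists_perm_succAbove π j
    have h1 : (fun k => (a ∘ π) (j.succAbove k)) = (fun k => a ((π j).succAbove k)) ∘ ρ := by
      funext k
      simp [hρ]
    have hs' : (-1 : ℝ) ^ (j : ℕ) * ((Equiv.Perm.sign ρ : ℤ) : ℝ) =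
        ((Equiv.Perm.sign π : ℤ) : ℝ) * (-1) ^ ((π j : Fin (q + 2)) : ℕ) := by
      exact_mod_cast hs
    rw [h1, hf.2 ρ, ← mul_assoc, hs', mul_assoc]
  · rw [coboundaryFun, coboundaryFun, if_neg ha,
      if_neg (fun h => ha ((isOrderedSimplex_comp_perm_iff π).1 h)), mul_zero]

/-- The coboundary operator `d_q : C^q(K) → C^{q+1}(K)`. -/
noncomputable def coboundary (K : AbstractSimplicialComplex V) (q : ℕ) :
    cochains K q →ₗ[ℝ] cochains K (q + 1) where
  toFun f := ⟨coboundaryFun K q f, coboundaryFun_mem K q f.2⟩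
  map_add' f g := by
    ext a
    by_cases ha : IsOrderedSimplex K a
    · simp [coboundaryFun, ha, mul_add, Finset.sum_add_distrib]
    · simp [coboundaryFun, ha]
  map_smul' c f := by
    ext a
    by_cases ha : IsOrderedSimplex K a
    · simp [coboundaryFun, ha, Finset.mul_sum, mul_left_comm]
    · simp [coboundaryFun, ha]

/-- The real Betti numbers `b^i(K) = dim Ker d_i - dim Im d_{i-1}` (with `d_{-1} = 0`) of a finite
complex `K`. -/
noncomputable def betti (K : AbstractSimplicialComplex V) : ℕ → ℤ
  | 0 => (Module.finrank ℝ (LinearMap.ker (coboundary K 0)) : ℤ)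
  | i + 1 => (Module.finrank ℝ (LinearMap.ker (coboundary K (i + 1))) : ℤ) -
      (Module.finrank ℝ (LinearMap.range (coboundary K i)) : ℤ)

end Cohomology

end BoundedComplex

open BoundedComplex

namespace BoundedComplex

/-! ### Ranks of integer matrices as traces of polynomials -/

section Spectral

open Matrix Polynomial

/-! This is Lück's approximation argument. By rank-nullity a Betti number in positive degree is an
alternating sum of ranks of integer matrices indexed by tuples of vertices (`betti_succ_eq_rank`).
Their entries are local: they are supported near the first vertex and determined by a ball around
it. The rank of such an `M` is the number of nonzero eigenvalues of `A = Mᵀ M`, which differs from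
the trace of `1 - (1 - A/Λ)^m` only through the small nonzero eigenvalues. Integrality makes these
rare, uniformly in the size of the complex: the product of the nonzero eigenvalues is, up to sign, a
nonzero integer, so their logarithms have nonnegative sum (`exists_abs_rank_sub_trace_le`). The
degree bound controls the row sums and, per vertex, the trace of `A`, so `m` and `Λ` do not depend
on the complex. A polynomial in `A` without constant term is again local, so its trace is a sum over
vertices of a function of a ball of fixed radius. Only finitely many balls occur, hence this sum is
`|V|` times a fixed linear combination of sampling probabilities (`IsLocalFun.exists_sum_eq`). Thus
`b^i/|V|` is a uniform limit of such combinations, which are continuous for the sampling topology.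
Uniformity in `i` holds because Betti numbers vanish above degree `d`. -/

theorem one_le_abs_trailingCoeff_map {p : ℤ[X]} (hp : p ≠ 0) :
    1 ≤ |(p.map (Int.castRingHom ℝ)).trailingCoeff| := by
  have h0 : p.map (Int.castRingHom ℝ) ≠ 0 :=
    (Polynomial.map_ne_zero_iff (RingHom.injective_int _)).2 hp
  have h1 := trailingCoeff_nonzero_iff_nonzero.2 h0
  rw [trailingCoeff, coeff_map, eq_intCast] at h1 ⊢
  have h2 : p.coeff (p.map (Int.castRingHom ℝ)).natTrailingDegree ≠ 0 := by
    exact_mod_cast h1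
  exact_mod_cast Int.one_le_abs h2

theorem trailingCoeff_X_sub_C (x : ℝ) :
    (X - C x : ℝ[X]).trailingCoeff = if x = 0 then 1 else -x := by
  split_ifs with h
  · simp [h, trailingCoeff]
  · rw [trailingCoeff_eq_coeff_zero (by simpa using h)]
    simp

theorem trailingCoeff_prod {ι : Type*} (s : Finset ι) (f : ι → ℝ[X]) :
    (∏ i ∈ s, f i).trailingCoeff = ∏ i ∈ s, (f i).trailingCoeff := by
  classical
  induction s using Finset.induction_on with
  | empty => simp [trailingCoeff]
  | insert a s ha ih => rw [Finset.prod_insert ha, Finset.prod_insert ha, trailingCoeff_mul, ih]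

/-- The logarithms of the nonzero eigenvalues of an integer matrix have nonnegative sum
(recall that `Real.log 0 = 0`). -/
theorem sum_log_eigenvalues_nonneg {ι : Type*} [Fintype ι] [DecidableEq ι] {A : Matrix ι ι ℝ}
    (hA : A.IsHermitian) (M : Matrix ι ι ℤ) (hM : A = M.map (Int.castRingHom ℝ)) :
    0 ≤ ∑ i, Real.log (hA.eigenvalues i) := by
  -- The lowest nonzero coefficient of the characteristic polynomial is, up to sign, the product of
  -- the nonzero eigenvalues. A zero eigenvalue contributes a factor `1`, in agreement with
  -- `Real.log 0 = 0`.
  have h1 := one_le_abs_trailingCoeff_map (M.charpoly_monic.ne_zero)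
  rw [← Matrix.charpoly_map, ← hM, hA.charpoly_eq, trailingCoeff_prod, Finset.abs_prod] at h1
  have h2 : ∀ i, Real.log (hA.eigenvalues i) =
      Real.log |(X - C (hA.eigenvalues i) : ℝ[X]).trailingCoeff| := by
    intro i
    rw [trailingCoeff_X_sub_C]
    split_ifs with h <;> simp [h]
  rw [Finset.sum_congr rfl fun i _ => h2 i, ← Real.log_prod]
  · exact Real.log_nonneg h1
  · intro i _
    rw [abs_ne_zero, trailingCoeff_nonzero_iff_nonzero]
    exact X_sub_C_ne_zero _

/-- The polynomial `1 - (1 - cA)^m` in the matrix `A`, computed without reference to an identity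
matrix. -/
noncomputable def rangeApprox {ι : Type*} [Fintype ι] (c : ℝ) (A : Matrix ι ι ℝ) :
    ℕ → Matrix ι ι ℝ
  | 0 => 0
  | m + 1 => rangeApprox c A m + c • A + (-c) • (A * rangeApprox c A m)

/-- The recursion avoids the identity because the identity on tuples is not a local kernel in
general: its diagonal is nonzero even at tuples with far apart entries. -/
theorem rangeApprox_eq {ι : Type*} [Fintype ι] [DecidableEq ι] (c : ℝ) (A : Matrix ι ι ℝ) (m : ℕ) :
    rangeApprox c A m = 1 - (1 - c • A) ^ m := by
  induction m with
  | zero => simp [rangeApprox]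
  | succ m ih =>
    rw [rangeApprox, ih, pow_succ']
    simp only [mul_sub, sub_mul, smul_mul_assoc, mul_one, one_mul, neg_smul, smul_sub]
    abel

theorem trace_rangeApprox {ι : Type*} [Fintype ι] [DecidableEq ι] {A : Matrix ι ι ℝ}
    (hA : A.IsHermitian) (c : ℝ) (m : ℕ) :
    (rangeApprox c A m).trace = ∑ i, (1 - (1 - c * hA.eigenvalues i) ^ m) := by
  have h : (1 - (1 - c • A) ^ m : Matrix ι ι ℝ) =
      Unitary.conjStarAlgAut ℝ _ hA.eigenvectorUnitary
        (diagonal fun i => (1 - (1 - c * hA.eigenvalues i) ^ m)) := by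
    conv_lhs => rw [hA.spectral_theorem]
    rw [← map_smul, ← map_one (Unitary.conjStarAlgAut ℝ _ hA.eigenvectorUnitary), ← map_sub,
      ← map_pow, ← map_sub]
    congr 1
    rw [← diagonal_one, ← diagonal_smul, diagonal_sub, diagonal_pow, diagonal_sub]
    rfl
  rw [rangeApprox_eq, h, Unitary.conjStarAlgAut_apply, Matrix.trace_mul_comm, ← mul_assoc]
  simp [Matrix.trace_diagonal]

/-- Gershgorin's circle theorem. -/
theorem abs_eigenvalue_le {ι : Type*} [Fintype ι] [DecidableEq ι] {A : Matrix ι ι ℝ}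
    (hA : A.IsHermitian) {Λ : ℝ} (hΛ : ∀ k, ∑ j, |A k j| ≤ Λ) (i : ι) :
    |hA.eigenvalues i| ≤ Λ := by
  have h : Module.End.HasEigenvalue (Matrix.toLin' A) (hA.eigenvalues i) := by
    refine Module.End.hasEigenvalue_of_hasEigenvector (x := ⇑(hA.eigenvectorBasis i)) ⟨?_, ?_⟩
    · rw [Module.End.mem_eigenspace_iff, Matrix.toLin'_apply]
      exact hA.mulVec_eigenvectorBasis i
    · intro h0
      exact hA.eigenvectorBasis.orthonormal.ne_zero i (by ext j; exact congrFun h0 j)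
  obtain ⟨k, hk⟩ := eigenvalue_mem_ball h
  rw [mem_closedBall_iff_norm, Real.norm_eq_abs] at hk
  calc |hA.eigenvalues i| = |(hA.eigenvalues i - A k k) + A k k| := by ring_nf
    _ ≤ |hA.eigenvalues i - A k k| + |A k k| := abs_add_le _ _
    _ ≤ ∑ j ∈ Finset.univ.erase k, |A k j| + |A k k| := by gcongr; exact hk
    _ = ∑ j, |A k j| := Finset.sum_erase_add _ _ (Finset.mem_univ k)
    _ ≤ Λ := hΛ k

/-- For `x ≤ exp (-T)` the term `-T⁻¹ log x` is at least `1` and pays for the power. For larger `x`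
the power is below `η / 2` once `m` is large, and the logarithm costs at most `log Λ / T ≤ η / 2`.
Summed over the nonzero eigenvalues, the logarithmic term can be dropped. -/
theorem exists_pow_le_sub_mul_log (Λ : ℝ) (hΛ : 1 ≤ Λ) (η : ℝ) (hη : 0 < η) :
    ∃ m : ℕ, ∃ c : ℝ, 0 ≤ c ∧
      ∀ x : ℝ, 0 < x → x ≤ Λ → (1 - Λ⁻¹ * x) ^ m ≤ η - c * Real.log x := by
  have hL := Real.log_nonneg hΛ
  set T : ℝ := 2 * (Real.log Λ + 1) / η with hT
  have hTpos : 0 < T := by positivity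
  have hTL : Real.log Λ / T ≤ η / 2 := by
    rw [div_le_iff₀ hTpos, hT]
    field_simp
    linarith
  set ε := Real.exp (-T) with hε
  have hεpos : 0 < ε := Real.exp_pos _
  have hΛpos : 0 < Λ := by linarith
  have hε1 : ε < 1 := by rw [hε, Real.exp_lt_one_iff]; linarith
  have hq0 : 0 ≤ 1 - Λ⁻¹ * ε := by
    have : Λ⁻¹ * ε ≤ 1 * 1 := mul_le_mul (inv_le_one_of_one_le₀ hΛ) hε1.le hεpos.le zero_le_one
    linarith
  have hq1 : 1 - Λ⁻¹ * ε < 1 := by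
    have : 0 < Λ⁻¹ * ε := by positivity
    linarith
  obtain ⟨m, hm⟩ := exists_pow_lt_of_lt_one (half_pos hη) hq1
  refine ⟨m, T⁻¹, by positivity, fun x hx hxΛ => ?_⟩
  have hb0 : 0 ≤ 1 - Λ⁻¹ * x := by
    rw [sub_nonneg, inv_mul_le_iff₀ hΛpos]; linarith
  have hlog : Real.log x ≤ Real.log Λ := Real.log_le_log hx hxΛ
  have hlog' : T⁻¹ * Real.log x ≤ Real.log Λ / T := by
    rw [div_eq_inv_mul]; gcongr
  by_cases hxε : x ≤ ε
  · have h1 : (1 - Λ⁻¹ * x) ^ m ≤ 1 := by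
      apply pow_le_one₀ hb0
      have : 0 < Λ⁻¹ * x := by positivity
      linarith
    have h2 : Real.log x ≤ -T := by
      rw [Real.log_le_iff_le_exp hx]; exact hxε
    have h3 : T⁻¹ * Real.log x ≤ T⁻¹ * (-T) := by gcongr
    have h4 : T⁻¹ * (-T) = -1 := by field_simp
    linarith
  · have h1 : (1 - Λ⁻¹ * x) ^ m ≤ (1 - Λ⁻¹ * ε) ^ m := by
      gcongr
      exact (not_le.1 hxε).le
    linarith

/-- The rank of an integer matrix `M` is approximated by the trace of a polynomial in `Mᵀ M`, where
the polynomial depends on the precision and on a bound for the absolute row sums of `Mᵀ M` only. -/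
theorem exists_abs_rank_sub_trace_le (Λ : ℝ) (hΛ : 1 ≤ Λ) (η : ℝ) (hη : 0 < η) :
    ∃ m : ℕ, ∀ {ι κ : Type u} [Fintype ι] [Fintype κ] (M : Matrix κ ι ℝ) (N : Matrix κ ι ℤ),
      M = N.map (Int.castRingHom ℝ) → (∀ k, ∑ j, |(Mᵀ * M) k j| ≤ Λ) →
      |(M.rank : ℝ) - (rangeApprox Λ⁻¹ (Mᵀ * M) m).trace| ≤ η * (Mᵀ * M).trace := by
  obtain ⟨m, c, hc, hm⟩ := exists_pow_le_sub_mul_log Λ hΛ η hη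
  refine ⟨m, fun {ι κ} _ _ M N hMN hrow => ?_⟩
  classical
  have hpsd : (Mᵀ * M).PosSemidef := by
    have := posSemidef_conjTranspose_mul_self M
    rwa [conjTranspose_eq_transpose_of_trivial] at this
  have hA : (Mᵀ * M).IsHermitian := hpsd.isHermitian
  have hint : Mᵀ * M = (Nᵀ * N).map (Int.castRingHom ℝ) := by
    rw [Matrix.map_mul, hMN, transpose_map]
  have hlog := sum_log_eigenvalues_nonneg hA _ hint
  have hnn : ∀ i, 0 ≤ hA.eigenvalues i := hpsd.eigenvalues_nonneg
  have hle : ∀ i, hA.eigenvalues i ≤ Λ := fun i =>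
    (le_abs_self _).trans (abs_eigenvalue_le hA hrow i)
  have hΛpos : 0 < Λ := by linarith
  have hrank : (M.rank : ℝ) = ∑ i, if hA.eigenvalues i ≠ 0 then (1 : ℝ) else 0 := by
    rw [← rank_transpose_mul_self M, hA.rank_eq_card_non_zero_eigs, Fintype.card_subtype,
      Finset.sum_boole]
  have htr : (Mᵀ * M).trace = ∑ i, hA.eigenvalues i := by
    simpa using hA.trace_eq_sum_eigenvalues
  rw [trace_rangeApprox hA, htr, hrank, ← Finset.sum_sub_distrib]
  have hterm : ∀ i, (if hA.eigenvalues i ≠ 0 then (1 : ℝ) else 0) -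
      (1 - (1 - Λ⁻¹ * hA.eigenvalues i) ^ m) =
        if hA.eigenvalues i ≠ 0 then (1 - Λ⁻¹ * hA.eigenvalues i) ^ m else 0 := by
    intro i
    by_cases h : hA.eigenvalues i = 0 <;> simp [h]
  rw [Finset.sum_congr rfl fun i _ => hterm i, abs_of_nonneg]
  · have h1 : ∀ i, (if hA.eigenvalues i ≠ 0 then (1 - Λ⁻¹ * hA.eigenvalues i) ^ m else 0) ≤
        η * hA.eigenvalues i - (c + η) * Real.log (hA.eigenvalues i) := by
      intro i
      by_cases h : hA.eigenvalues i = 0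
      · simp [h]
      · have hpos := lt_of_le_of_ne (hnn i) (Ne.symm h)
        rw [if_pos h]
        have h2 := hm _ hpos (hle i)
        have h3 := Real.log_le_sub_one_of_pos hpos
        have h4 := mul_le_mul_of_nonneg_left h3 hη.le
        linarith
    refine (Finset.sum_le_sum fun i _ => h1 i).trans ?_
    rw [Finset.sum_sub_distrib, ← Finset.mul_sum, ← Finset.mul_sum]
    have : 0 ≤ (c + η) * ∑ i, Real.log (hA.eigenvalues i) := by positivity
    linarith
  · refine Finset.sum_nonneg fun i _ => ?_
    split_ifs
    · apply pow_nonneg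
      rw [sub_nonneg, inv_mul_le_iff₀ hΛpos]
      linarith [hle i]
    · exact le_rfl

end Spectral

/-! ### Full subcomplexes -/

section FullEmbedding

variable {V : Type u} {W : Type v}

/-- `L` is a full subcomplex of `K` by way of the embedding `e`. -/
def IsFullEmbedding (L : AbstractSimplicialComplex W) (K : AbstractSimplicialComplex V)
    (e : W ↪ V) : Prop :=
  ∀ s : Finset W, s ∈ L.faces ↔ s.map e ∈ K.faces

theorem IsFullEmbedding.isOrderedSimplex_iff {L : AbstractSimplicialComplex W}
    {K : AbstractSimplicialComplex V} {e : W ↪ V} (he : IsFullEmbedding L K e) {q : ℕ}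
    (a : Fin (q + 1) → W) : IsOrderedSimplex L a ↔ IsOrderedSimplex K (e ∘ a) := by
  have key : ∀ (h : Function.Injective a) (h' : Function.Injective (e ∘ a)),
      (Finset.univ.map ⟨a, h⟩ ∈ L.faces ↔ Finset.univ.map ⟨e ∘ a, h'⟩ ∈ K.faces) := by
    intro h h'
    rw [he, Finset.map_map]
    rfl
  constructor
  · rintro ⟨h, ha⟩
    exact ⟨e.injective.comp h, (key h _).1 ha⟩
  · rintro ⟨h, ha⟩
    exact ⟨h.of_comp, (key h.of_comp h).2 ha⟩

theorem IsFullEmbedding.skeleton_adj_iff {L : AbstractSimplicialComplex W}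
    {K : AbstractSimplicialComplex V} {e : W ↪ V} (he : IsFullEmbedding L K e) (x y : W) :
    (skeleton L).Adj x y ↔ (skeleton K).Adj (e x) (e y) := by
  classical
  refine and_congr e.injective.ne_iff.symm ?_
  rw [he, Finset.map_eq_image]
  refine iff_of_eq (congrArg (· ∈ K.faces) ?_)
  ext z
  simp

/-- Walks can be pushed forward. Equality may fail, as a shortest path in `K` can leave the image.
-/
theorem IsFullEmbedding.edist_le {L : AbstractSimplicialComplex W}
    {K : AbstractSimplicialComplex V} {e : W ↪ V} (he : IsFullEmbedding L K e) (x y : W) :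
    (skeleton K).edist (e x) (e y) ≤ (skeleton L).edist x y := by
  refine le_iInf fun w => ?_
  let φ : skeleton L →g skeleton K := ⟨e, fun h => (he.skeleton_adj_iff _ _).1 h⟩
  have := (w.map φ).edist_le
  rwa [SimpleGraph.Walk.length_map] at this

theorem IsOrderedSimplex.edist_le_one {K : AbstractSimplicialComplex V} {q : ℕ}
    {a : Fin (q + 1) → V} (h : IsOrderedSimplex K a) (i j : Fin (q + 1)) :
    (skeleton K).edist (a i) (a j) ≤ 1 := by
  classical
  obtain ⟨hinj, hmem⟩ := h
  rw [SimpleGraph.edist_le_one_iff_adj_or_eq]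
  by_cases hij : a i = a j
  · exact Or.inr hij
  · refine Or.inl ⟨hij, (K.isRelLowerSet_faces hmem).2 ?_ (by simp)⟩
    intro x hx
    simp only [Finset.mem_insert, Finset.mem_singleton] at hx
    rcases hx with rfl | rfl <;> simp

theorem ballVertices_subset_ballVertices {K : AbstractSimplicialComplex V} {s t : ℕ} {x y : V}
    (h : (skeleton K).edist x y ≤ s) : ballVertices K t y ⊆ ballVertices K (s + t) x := by
  intro z hz
  have hz' : (skeleton K).edist y z ≤ t := hz
  change (skeleton K).edist x z ≤ ((s + t : ℕ) : ℕ∞)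
  push_cast
  exact SimpleGraph.edist_triangle.trans (add_le_add h hz')

theorem ballVertices_mono {K : AbstractSimplicialComplex V} {s t : ℕ} (h : s ≤ t) (x : V) :
    ballVertices K s x ⊆ ballVertices K t x := fun z hz =>
  show (skeleton K).edist x z ≤ t from le_trans hz (by exact_mod_cast h)

theorem mem_range_of_edist_le {K : AbstractSimplicialComplex V} {s : ℕ} {x : V} {e : W ↪ V}
    {q : ℕ} {b : Fin (q + 1) → V} (hr : ballVertices K s x ⊆ Set.range e)
    (hb : ∀ j, (skeleton K).edist x (b j) ≤ s) : ∃ b' : Fin (q + 1) → W, e ∘ b' = b := by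
  choose b' hb' using fun j => hr (hb j)
  exact ⟨b', funext hb'⟩

theorem sum_comp_embedding [Fintype V] [Fintype W] (e : W ↪ V) {q : ℕ}
    {f : (Fin (q + 1) → W) → ℝ} {g : (Fin (q + 1) → V) → ℝ}
    (hfg : ∀ b, f b = g (e ∘ b)) (hg : ∀ b, g b ≠ 0 → ∃ b', e ∘ b' = b) :
    ∑ b, f b = ∑ b, g b := by
  refine Fintype.sum_of_injective (fun b : Fin (q + 1) → W => e ∘ b) ?_ f g ?_ hfg
  · intro b b' h
    funext j
    exact e.injective (congrFun h j)
  · intro b hb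
    by_contra h
    obtain ⟨b', h'⟩ := hg b h
    exact hb ⟨b', h'⟩

end FullEmbedding

/-! ### Local kernels and local functions -/

section Locality

/-- A family of matrices indexed by the tuples of vertices of finite complexes. -/
abbrev KernelFamily (m n : ℕ) : Type (u + 1) :=
  ∀ (V : Type u) [Fintype V], AbstractSimplicialComplex V →
    Matrix (Fin (m + 1) → V) (Fin (n + 1) → V) ℝ

/-- The entries of the kernel vanish at tuples which are not within distance `s` of the first
vertex, and depend on the `s`-ball of the first vertex only. -/
structure IsLocalKernel {m n : ℕ} (s : ℕ) (X : KernelFamily.{u} m n) : Prop where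
  near_left : ∀ {V : Type u} [Fintype V] (K : AbstractSimplicialComplex V) a c,
    X V K a c ≠ 0 → ∀ j, (skeleton K).edist (a 0) (a j) ≤ s
  near_right : ∀ {V : Type u} [Fintype V] (K : AbstractSimplicialComplex V) a c,
    X V K a c ≠ 0 → ∀ j, (skeleton K).edist (a 0) (c j) ≤ s
  natural : ∀ {V W : Type u} [Fintype V] [Fintype W] (K : AbstractSimplicialComplex V)
    (L : AbstractSimplicialComplex W) (e : W ↪ V), IsFullEmbedding L K e → ∀ a c,
    ballVertices K s (e (a 0)) ⊆ Set.range e → X W L a c = X V K (e ∘ a) (e ∘ c)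

variable {l m n : ℕ}

theorem IsLocalKernel.mono {s t : ℕ} (h : s ≤ t) {X : KernelFamily.{u} m n}
    (hX : IsLocalKernel s X) : IsLocalKernel t X where
  near_left K a c hac j := (hX.near_left K a c hac j).trans (by exact_mod_cast h)
  near_right K a c hac j := (hX.near_right K a c hac j).trans (by exact_mod_cast h)
  natural K L e he a c hr := hX.natural K L e he a c ((ballVertices_mono h _).trans hr)

theorem IsLocalKernel.zero : IsLocalKernel 0 (fun _ _ _ => 0 : KernelFamily.{u} m n) where
  near_left := by simp
  near_right := by simp
  natural := by simp

theorem IsLocalKernel.add {s t : ℕ} {X Y : KernelFamily.{u} m n} (hX : IsLocalKernel s X)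
    (hY : IsLocalKernel t Y) : IsLocalKernel (s + t) (fun V _ K => X V K + Y V K) := by
  replace hX := hX.mono (Nat.le_add_right s t)
  replace hY := hY.mono (Nat.le_add_left t s)
  have key : ∀ {x y : ℝ}, x + y ≠ 0 → x ≠ 0 ∨ y ≠ 0 := by
    intro x y h
    by_contra! h'
    exact h (by simp [h'])
  constructor
  · intro V _ K a c hac
    rcases key hac with h | h
    exacts [hX.near_left K a c h, hY.near_left K a c h]
  · intro V _ K a c hac
    rcases key hac with h | h
    exacts [hX.near_right K a c h, hY.near_right K a c h]
  · intro V W _ _ K L e he a c hr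
    simp only [Matrix.add_apply, hX.natural K L e he a c hr, hY.natural K L e he a c hr]

theorem IsLocalKernel.smul {s : ℕ} {X : KernelFamily.{u} m n} (hX : IsLocalKernel s X) (r : ℝ) :
    IsLocalKernel s (fun V _ K => r • X V K) where
  near_left K a c hac := hX.near_left K a c (right_ne_zero_of_mul hac)
  near_right K a c hac := hX.near_right K a c (right_ne_zero_of_mul hac)
  natural K L e he a c hr := by simp only [Matrix.smul_apply, hX.natural K L e he a c hr]

/-- Radii add: an intermediate tuple `b` that contributes starts within `s` of `a 0`, so the
`t`-ball around `b 0` lies in the `(s + t)`-ball around `a 0`. -/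
theorem IsLocalKernel.mul {s t : ℕ} {X : KernelFamily.{u} l m} {Y : KernelFamily.{u} m n}
    (hX : IsLocalKernel s X) (hY : IsLocalKernel t Y) :
    IsLocalKernel (s + t) (fun V _ K => X V K * Y V K) := by
  have key : ∀ {V : Type u} [Fintype V] (K : AbstractSimplicialComplex V) a c,
      (X V K * Y V K) a c ≠ 0 → ∃ b, X V K a b ≠ 0 ∧ Y V K b c ≠ 0 := by
    intro V _ K a c hac
    obtain ⟨b, -, hb⟩ := Finset.exists_ne_zero_of_sum_ne_zero hac
    exact ⟨b, left_ne_zero_of_mul hb, right_ne_zero_of_mul hb⟩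
  constructor
  · intro V _ K a c hac
    obtain ⟨b, hb, -⟩ := key K a c hac
    exact (hX.mono (Nat.le_add_right s t)).near_left K a b hb
  · intro V _ K a c hac j
    obtain ⟨b, hb, hb'⟩ := key K a c hac
    push_cast
    exact SimpleGraph.edist_triangle.trans
      (add_le_add (hX.near_right K a b hb 0) (hY.near_right K b c hb' j))
  · intro V W _ _ K L e he a c hr
    have hrs := (ballVertices_mono (Nat.le_add_right s t) _).trans hr
    refine sum_comp_embedding e (fun b => ?_) fun b hb => ?_
    · change X W L a b * Y W L b c = X V K (e ∘ a) (e ∘ b) * Y V K (e ∘ b) (e ∘ c)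
      rw [hX.natural K L e he a b hrs]
      by_cases h0 : X V K (e ∘ a) (e ∘ b) = 0
      · simp [h0]
      · rw [hY.natural K L e he b c]
        exact (ballVertices_subset_ballVertices (hX.near_right K _ _ h0 0)).trans hr
    · exact mem_range_of_edist_le hrs (hX.near_right K (e ∘ a) b (left_ne_zero_of_mul hb))

/-- Transposition moves the base point from `a 0` to `c 0`, which costs one more radius `s`. -/
theorem IsLocalKernel.transpose {s : ℕ} {X : KernelFamily.{u} m n} (hX : IsLocalKernel s X) :
    IsLocalKernel (s + s) (fun V _ K => (X V K).transpose) := by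
  have key : ∀ {V : Type u} [Fintype V] (K : AbstractSimplicialComplex V) a c,
      X V K a c ≠ 0 → (skeleton K).edist (c 0) (a 0) ≤ s := by
    intro V _ K a c hac
    rw [SimpleGraph.edist_comm]
    exact hX.near_right K a c hac 0
  constructor
  · intro V _ K c a hac j
    push_cast
    exact SimpleGraph.edist_triangle.trans
      (add_le_add (key K a c hac) (hX.near_right K a c hac j))
  · intro V _ K c a hac j
    push_cast
    exact SimpleGraph.edist_triangle.trans
      (add_le_add (key K a c hac) (hX.near_left K a c hac j))
  · intro V W _ _ K L e he c a hr
    change X W L a c = X V K (e ∘ a) (e ∘ c)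
    -- If the base points are far apart in `K`, they are so in `L` too, and both entries vanish.
    by_cases h : (skeleton K).edist (e (c 0)) (e (a 0)) ≤ s
    · exact hX.natural K L e he a c ((ballVertices_subset_ballVertices h).trans hr)
    · have h1 : X W L a c = 0 := by
        by_contra h1
        exact h ((he.edist_le _ _).trans (key L a c h1))
      have h2 : X V K (e ∘ a) (e ∘ c) = 0 := by
        by_contra h2
        exact h (key K _ _ h2)
      rw [h1, h2]

theorem IsLocalKernel.rangeApprox {s : ℕ} {X : KernelFamily.{u} m m} (hX : IsLocalKernel s X)
    (c : ℝ) (k : ℕ) : ∃ t, IsLocalKernel t (fun V _ K => rangeApprox c (X V K) k) := by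
  induction k with
  | zero => exact ⟨0, IsLocalKernel.zero⟩
  | succ k ih =>
    obtain ⟨t, ht⟩ := ih
    exact ⟨_, (ht.add (hX.smul c)).add ((hX.mul ht).smul (-c))⟩

/-- A function of the vertices of finite complexes which depends on the `s`-ball of the vertex
only. -/
def IsLocalFun (s : ℕ) (f : ∀ (V : Type u) [Fintype V], AbstractSimplicialComplex V → V → ℝ) :
    Prop :=
  ∀ ⦃V W : Type u⦄ [Fintype V] [Fintype W] (K : AbstractSimplicialComplex V)
    (L : AbstractSimplicialComplex W) (e : W ↪ V), IsFullEmbedding L K e → ∀ x,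
    ballVertices K s (e x) ⊆ Set.range e → f W L x = f V K (e x)

theorem IsLocalFun.mono {s t : ℕ} (h : s ≤ t)
    {f : ∀ (V : Type u) [Fintype V], AbstractSimplicialComplex V → V → ℝ}
    (hf : IsLocalFun s f) : IsLocalFun t f :=
  fun _ _ _ _ K L e he x hr => hf K L e he x ((ballVertices_mono h _).trans hr)

open Classical in
/-- The sum of a function of tuples over the tuples with first vertex `p`. -/
noncomputable def sumAt {V : Type u} [Fintype V] (φ : (Fin (m + 1) → V) → ℝ) (p : V) : ℝ :=
  ∑ a, if a 0 = p then φ a else 0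

theorem sum_sumAt {V : Type u} [Fintype V] (φ : (Fin (m + 1) → V) → ℝ) :
    ∑ p, sumAt φ p = ∑ a, φ a := by
  classical
  unfold sumAt
  rw [Finset.sum_comm]
  simp

theorem le_sumAt {V : Type u} [Fintype V] {φ : (Fin (m + 1) → V) → ℝ} (h : ∀ a, 0 ≤ φ a)
    (a : Fin (m + 1) → V) : φ a ≤ sumAt φ (a 0) := by
  classical
  have := Finset.single_le_sum (f := fun b => if b 0 = a 0 then φ b else 0)
    (fun b _ => by split_ifs; exacts [h b, le_rfl]) (Finset.mem_univ a)
  rw [if_pos rfl] at this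
  exact this

/-- Every tuple that contributes at `p` lies inside the `s`-ball of `p`, hence in the image of the
embedding. -/
theorem isLocalFun_sumAt {s : ℕ}
    (φ : ∀ (V : Type u) [Fintype V], AbstractSimplicialComplex V → (Fin (m + 1) → V) → ℝ)
    (hnear : ∀ {V : Type u} [Fintype V] (K : AbstractSimplicialComplex V) a,
      φ V K a ≠ 0 → ∀ j, (skeleton K).edist (a 0) (a j) ≤ s)
    (hnat : ∀ {V W : Type u} [Fintype V] [Fintype W] (K : AbstractSimplicialComplex V)
      (L : AbstractSimplicialComplex W) (e : W ↪ V), IsFullEmbedding L K e → ∀ a,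
      ballVertices K s (e (a 0)) ⊆ Set.range e → φ W L a = φ V K (e ∘ a)) :
    IsLocalFun s (fun V _ K p => sumAt (φ V K) p) := by
  classical
  intro V W _ _ K L e he x hr
  refine sum_comp_embedding e (fun a => ?_) fun a ha => ?_
  · simp only [Function.comp_apply, EmbeddingLike.apply_eq_iff_eq]
    split_ifs with h
    · exact hnat K L e he a (by rwa [h])
    · rfl
  · rw [ne_eq, ite_eq_right_iff, Classical.not_imp] at ha
    refine mem_range_of_edist_le hr fun j => ?_
    rw [← ha.1]
    exact hnear K a ha.2 j

theorem IsLocalKernel.isLocalFun_trace {s : ℕ} {X : KernelFamily.{u} m m}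
    (hX : IsLocalKernel s X) :
    IsLocalFun s (fun V _ K p => sumAt (fun a => X V K a a) p) :=
  isLocalFun_sumAt (fun V _ K a => X V K a a) (fun K a ha => hX.near_left K a a ha)
    fun K L e he a hr => hX.natural K L e he a a hr

theorem IsLocalKernel.isLocalFun_rowSum {s : ℕ} {X : KernelFamily.{u} m n}
    (hX : IsLocalKernel s X) :
    IsLocalFun s (fun V _ K p => sumAt (fun a => ∑ c, |X V K a c|) p) := by
  refine isLocalFun_sumAt (fun V _ K a => ∑ c, |X V K a c|) (fun K a ha => ?_)
    fun K L e he a hr => ?_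
  · obtain ⟨c, -, hc⟩ := Finset.exists_ne_zero_of_sum_ne_zero ha
    exact hX.near_left K a c (abs_ne_zero.1 hc)
  · refine sum_comp_embedding e (fun c => ?_) fun c hc => ?_
    · rw [hX.natural K L e he a c hr]
    · exact mem_range_of_edist_le hr (hX.near_right K _ c (abs_ne_zero.1 hc))

open Classical in
/-- The kernel of the operator which takes `f` to the function of ordered simplices
`a ↦ ∑ i, w i * f (a ∘ σ i)`. -/
noncomputable def simplexKernel {ι : Type} [Fintype ι] (w : ι → ℤ)
    (σ : ι → Fin (n + 1) → Fin (m + 1)) : KernelFamily.{u} m n :=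
  fun _ _ K a b => if IsOrderedSimplex K a then ∑ i, if b = a ∘ σ i then (w i : ℝ) else 0 else 0

theorem isLocalKernel_simplexKernel {ι : Type} [Fintype ι] (w : ι → ℤ)
    (σ : ι → Fin (n + 1) → Fin (m + 1)) : IsLocalKernel 1 (simplexKernel.{u} w σ) := by
  classical
  constructor
  · intro V _ K a c hac j
    rw [simplexKernel, ne_eq, ite_eq_right_iff, Classical.not_imp] at hac
    exact hac.1.edist_le_one 0 j
  · intro V _ K a c hac j
    rw [simplexKernel, ne_eq, ite_eq_right_iff, Classical.not_imp] at hac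
    obtain ⟨i, -, hi⟩ := Finset.exists_ne_zero_of_sum_ne_zero hac.2
    rw [ne_eq, ite_eq_right_iff, Classical.not_imp] at hi
    rw [hi.1]
    exact hac.1.edist_le_one 0 _
  · intro V W _ _ K L e he a c _
    have h : ∀ i, (e ∘ c = (e ∘ a) ∘ σ i ↔ c = a ∘ σ i) := by
      intro i
      rw [Function.comp_assoc]
      exact e.injective.comp_left.eq_iff
    simp only [simplexKernel, he.isOrderedSimplex_iff, h]

theorem simplexKernel_eq_map {ι : Type} [Fintype ι] (w : ι → ℤ)
    (σ : ι → Fin (n + 1) → Fin (m + 1)) (V : Type u) [Fintype V]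
    (K : AbstractSimplicialComplex V) :
    ∃ N : Matrix (Fin (m + 1) → V) (Fin (n + 1) → V) ℤ,
      simplexKernel w σ V K = N.map (Int.castRingHom ℝ) := by
  classical
  refine ⟨Matrix.of fun a b =>
    if IsOrderedSimplex K a then ∑ i, if b = a ∘ σ i then w i else 0 else 0, ?_⟩
  ext a b
  simp only [simplexKernel, Matrix.map_apply, Matrix.of_apply, eq_intCast]
  split_ifs
  · push_cast
    rfl
  · simp

theorem simplexKernel_mulVec {ι : Type} [Fintype ι] (w : ι → ℤ)
    (σ : ι → Fin (n + 1) → Fin (m + 1)) {V : Type u} [Fintype V]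
    (K : AbstractSimplicialComplex V) (f : (Fin (n + 1) → V) → ℝ) (a : Fin (m + 1) → V)
    [Decidable (IsOrderedSimplex K a)] :
    (simplexKernel w σ V K).mulVec f a =
      if IsOrderedSimplex K a then ∑ i, (w i : ℝ) * f (a ∘ σ i) else 0 := by
  classical
  simp only [Matrix.mulVec, dotProduct, simplexKernel]
  split_ifs
  · simp only [Finset.sum_mul, ite_mul, zero_mul]
    rw [Finset.sum_comm]
    simp
  · simp

end Locality

/-! ### Balls and the finiteness of their types -/

section Balls

variable {V : Type u} {W : Type v}

theorem isFullEmbedding_ball (K : AbstractSimplicialComplex V) (r : ℕ) (p : V) :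
    IsFullEmbedding (ball K r p) K (Function.Embedding.subtype _) := fun _ => Iff.rfl

theorem IsFullEmbedding.degreeLE {L : AbstractSimplicialComplex W}
    {K : AbstractSimplicialComplex V} {e : W ↪ V} (he : IsFullEmbedding L K e) {d : ℕ}
    (hK : DegreeLE d K) : DegreeLE d L := by
  intro x
  rw [← e.injective.injOn.encard_image]
  refine (Set.encard_le_encard ?_).trans (hK (e x))
  rintro _ ⟨y, hy, rfl⟩
  exact (he.skeleton_adj_iff x y).1 hy

/-- Along the walk the distance from `p` grows by at most one per step while the remaining length
drops by one. The hypothesis `h` therefore persists and keeps the walk inside the ball. -/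
theorem edist_ball_le_length (K : AbstractSimplicialComplex V) (r : ℕ) (p : V) {u x : V}
    (w : (skeleton K).Walk u x) (hu : u ∈ ballVertices K r p) (hx : x ∈ ballVertices K r p)
    (h : (skeleton K).edist p u + w.length ≤ r) :
    (skeleton (ball K r p)).edist ⟨u, hu⟩ ⟨x, hx⟩ ≤ w.length := by
  induction w with
  | nil => simp
  | @cons u v x huv w ih =>
    have h1 : (skeleton K).edist u v = 1 := SimpleGraph.edist_eq_one_iff_adj.2 huv
    have h2 : (skeleton K).edist p v + w.length ≤ r := by
      refine le_trans ?_ h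
      calc (skeleton K).edist p v + w.length
          ≤ (skeleton K).edist p u + (skeleton K).edist u v + w.length := by
            gcongr
            exact SimpleGraph.edist_triangle
        _ = _ := by rw [h1, SimpleGraph.Walk.length_cons]; push_cast; ring
    have hv : v ∈ ballVertices K r p := le_trans le_self_add h2
    have h3 : (skeleton (ball K r p)).edist ⟨u, hu⟩ ⟨v, hv⟩ = 1 := by
      rw [SimpleGraph.edist_eq_one_iff_adj]
      exact ((isFullEmbedding_ball K r p).skeleton_adj_iff ⟨u, hu⟩ ⟨v, hv⟩).2 huv
    calc (skeleton (ball K r p)).edist ⟨u, hu⟩ ⟨x, hx⟩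
        ≤ (skeleton (ball K r p)).edist ⟨u, hu⟩ ⟨v, hv⟩ +
          (skeleton (ball K r p)).edist ⟨v, hv⟩ ⟨x, hx⟩ := SimpleGraph.edist_triangle
      _ ≤ 1 + w.length := by rw [h3]; gcongr; exact ih hv hx h2
      _ = _ := by rw [SimpleGraph.Walk.length_cons]; push_cast; ring

theorem edist_ballRoot_le (K : AbstractSimplicialComplex V) (r : ℕ) (p : V)
    (x : ballVertices K r p) : (skeleton (ball K r p)).edist (ballRoot K r p) x ≤ r := by
  have hx : (skeleton K).edist p x ≤ r := x.2
  obtain ⟨w, hw⟩ := SimpleGraph.exists_walk_of_edist_ne_top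
    (ne_top_of_le_ne_top (ENat.natCast_ne_top r) hx)
  rw [← hw] at hx
  exact (edist_ball_le_length K r p w (center_mem_ballVertices K r p) x.2
    (by simpa using hx)).trans hx

theorem card_ballVertices_le [Fintype V] {K : AbstractSimplicialComplex V} {d : ℕ}
    (hK : DegreeLE d K) (r : ℕ) (p : V) : (ballVertices K r p).encard ≤ ((d + 1) ^ r : ℕ) := by
  classical
  induction r with
  | zero =>
    have : ballVertices K 0 p = {p} := by
      ext x
      change (skeleton K).edist p x ≤ ((0 : ℕ) : ℕ∞) ↔ x = p
      rw [Nat.cast_zero, nonpos_iff_eq_zero, SimpleGraph.edist_eq_zero_iff, eq_comm]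
    simp [this]
  | succ r ih =>
    have hsub : (ballVertices K (r + 1) p).toFinset ⊆ (ballVertices K r p).toFinset.biUnion
        fun x => insert x ((skeleton K).neighborSet x).toFinset := by
      intro z hz
      rw [Set.mem_toFinset] at hz
      have hz' : (skeleton K).edist z p ≤ ((r + 1 : ℕ) : ℕ∞) := by
        rw [SimpleGraph.edist_comm]
        exact hz
      obtain ⟨w, hw⟩ := SimpleGraph.exists_walk_of_edist_ne_top
        (ne_top_of_le_ne_top (ENat.natCast_ne_top _) hz')
      rw [← hw] at hz'
      simp only [Finset.mem_biUnion, Set.mem_toFinset, Finset.mem_insert]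
      cases w with
      | nil => exact ⟨p, center_mem_ballVertices K r p, Or.inl rfl⟩
      | @cons _ x _ hzx w =>
        refine ⟨x, ?_, Or.inr hzx.symm⟩
        have : w.length ≤ r := by
          rw [SimpleGraph.Walk.length_cons] at hz'
          exact Nat.succ_le_succ_iff.1 (by exact_mod_cast hz')
        change (skeleton K).edist p x ≤ r
        rw [SimpleGraph.edist_comm]
        exact (SimpleGraph.edist_le w).trans (by exact_mod_cast this)
    rw [Set.encard_eq_coe_toFinset_card] at ih ⊢
    norm_cast at ih ⊢
    refine (Finset.card_le_card hsub).trans ?_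
    refine (Finset.card_biUnion_le_card_mul _ _ (d + 1) fun x _ => ?_).trans ?_
    · have := hK x
      rw [Set.encard_eq_coe_toFinset_card] at this
      norm_cast at this
      exact (Finset.card_insert_le _ _).trans (by omega)
    · rw [pow_succ]
      gcongr

theorem RootedBall.n_le {r d : ℕ} (A : RootedBall r d) : A.n ≤ (d + 1) ^ r := by
  have h : ballVertices A.complex r A.root = Set.univ := Set.eq_univ_of_forall A.edist_le
  have := card_ballVertices_le A.degreeLE r A.root
  rw [h, Set.encard_univ, ENat.card_eq_coe_fintype_card, Fintype.card_fin] at this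
  exact_mod_cast this

theorem finite_rootedBall (r d : ℕ) : Finite (RootedBall r d) := by
  let φ : RootedBall r d →
      Σ n : Fin ((d + 1) ^ r + 1), Set (Finset (Fin n)) × Fin n :=
    fun A => ⟨⟨A.n, Nat.lt_succ_of_le A.n_le⟩, A.complex.faces, A.root⟩
  refine Finite.of_injective φ ?_
  rintro ⟨n, K, x, hK, hx⟩ ⟨n', K', x', hK', hx'⟩ h
  simp only [φ, Sigma.mk.injEq, Fin.mk.injEq] at h
  obtain ⟨rfl, h⟩ := h
  simp only [heq_eq_eq, Prod.mk.injEq] at h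
  obtain ⟨h1, rfl⟩ := h
  have : K = K' := by
    rcases K with ⟨⟨F, hF⟩, hF'⟩
    rcases K' with ⟨⟨F', hG⟩, hG'⟩
    simpa using h1
  subst this
  rfl

instance finite_ballClass (r d : ℕ) : Finite (BallClass r d) :=
  haveI := finite_rootedBall r d
  inferInstanceAs (Finite (Quotient _))

/-- The complex on `W` which corresponds to `K` under a bijection of the vertices. -/
def transport (K : AbstractSimplicialComplex V) (e : W ≃ V) : AbstractSimplicialComplex W where
  faces := {s | s.map e.toEmbedding ∈ K.faces}
  isRelLowerSet_faces := by
    intro s hs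
    refine ⟨Finset.map_nonempty.1 (K.isRelLowerSet_faces hs).1, fun t hts ht => ?_⟩
    exact (K.isRelLowerSet_faces hs).2 (Finset.map_subset_map.2 hts) (Finset.map_nonempty.2 ht)
  singleton_mem x := by
    simpa using K.singleton_mem (e x)

theorem rootedIso_transport (K : AbstractSimplicialComplex V) (e : W ≃ V) (x : V) :
    RootedIso K x (transport K e) (e.symm x) := by
  refine RootedIso.symm ⟨e, by simp, fun s => Iff.rfl⟩

theorem exists_mem_verticesOfType [Finite V] {K : AbstractSimplicialComplex V} {d : ℕ}
    (hK : DegreeLE d K) (r : ℕ) (p : V) : ∃ α : BallClass r d, p ∈ verticesOfType K α := by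
  let e : Fin (Nat.card (ballVertices K r p)) ≃ ballVertices K r p :=
    (Finite.equivFin (ballVertices K r p)).symm
  have he : IsFullEmbedding (transport (ball K r p) e) (ball K r p) e.toEmbedding :=
    fun _ => Iff.rfl
  have he' : IsFullEmbedding (ball K r p) (transport (ball K r p) e) e.symm.toEmbedding := by
    intro s
    change _ ↔ (s.map e.symm.toEmbedding).map e.toEmbedding ∈ (ball K r p).faces
    rw [Finset.map_map, ← Equiv.trans_toEmbedding, Equiv.symm_trans_self,
      Equiv.refl_toEmbedding, Finset.map_refl]
  refine ⟨Quotient.mk _ ⟨_, transport (ball K r p) e, e.symm (ballRoot K r p), ?_, ?_⟩, _, rfl,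
    rootedIso_transport _ e _⟩
  · exact he.degreeLE ((isFullEmbedding_ball K r p).degreeLE hK)
  · intro y
    have := he'.edist_le (ballRoot K r p) (e y)
    simp only [Equiv.coe_toEmbedding, Equiv.symm_apply_apply] at this
    exact this.trans (edist_ballRoot_le K r p _)

theorem eq_of_mem_verticesOfType {K : AbstractSimplicialComplex V} {r d : ℕ} {p : V}
    {α β : BallClass r d} (hα : p ∈ verticesOfType K α) (hβ : p ∈ verticesOfType K β) :
    α = β := by
  obtain ⟨A, rfl, hA⟩ := hα
  obtain ⟨B, rfl, hB⟩ := hβ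
  exact Quotient.sound (hA.symm.trans hB)

theorem samplingProb_nonneg (K : AbstractSimplicialComplex V) {r d : ℕ} (α : BallClass r d) :
    0 ≤ samplingProb K α := by
  unfold samplingProb
  positivity

theorem samplingProb_le_one [Finite V] (K : AbstractSimplicialComplex V) {r d : ℕ}
    (α : BallClass r d) : samplingProb K α ≤ 1 := by
  refine div_le_one_of_le₀ ?_ (Nat.cast_nonneg _)
  exact_mod_cast Set.ncard_le_card _

/-- The class of rooted `r`-balls `α` as an element of the disjoint union of all the classes. -/
def AllBalls.mk {r d : ℕ} (hr : 1 ≤ r) (α : BallClass r d) : AllBalls d := ⟨⟨r, hr⟩, α⟩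

/-- The sampling probability of an element of the disjoint union of all the classes of balls. -/
noncomputable def ballProb (K : AbstractSimplicialComplex V) {d : ℕ} (α : AllBalls d) : ℝ :=
  samplingProb K α.2

theorem ballProb_mk (K : AbstractSimplicialComplex V) {r d : ℕ} (hr : 1 ≤ r)
    (α : BallClass r d) : ballProb K (AllBalls.mk hr α) = samplingProb K α := rfl

end Balls

/-! ### Sums of local functions through sampling probabilities -/

section LocalFunctions

variable {s d : ℕ} {f : ∀ (V : Type u) [Fintype V], AbstractSimplicialComplex V → V → ℝ}

/-- Each value equals the value at the root of the ball, regarded as a complex in its own right. -/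
theorem IsLocalFun.eq_of_rootedIso (hf : IsLocalFun s f) {V W : Type u} [Fintype V] [Fintype W]
    {K : AbstractSimplicialComplex V} {L : AbstractSimplicialComplex W} {p : V} {q : W}
    (h : RootedIso (ball K s p) (ballRoot K s p) (ball L s q) (ballRoot L s q)) :
    f V K p = f W L q := by
  classical
  let _ := Fintype.ofFinite (ballVertices K s p)
  let _ := Fintype.ofFinite (ballVertices L s q)
  obtain ⟨e, he, hs⟩ := h
  have h1 := hf K _ _ (isFullEmbedding_ball K s p) (ballRoot K s p) (by simp [ballRoot])
  have h2 := hf L _ _ (isFullEmbedding_ball L s q) (ballRoot L s q) (by simp [ballRoot])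
  have h3 := hf (ball L s q) (ball K s p) e.toEmbedding hs (ballRoot K s p)
    (by simp [e.surjective.range_eq])
  rw [Equiv.coe_toEmbedding, he, h1, h2] at h3
  exact h3

theorem IsLocalFun.exists_ballClass_fun (hf : IsLocalFun s f) (d : ℕ) :
    ∃ g : BallClass s d → ℝ, ∀ {V : Type u} [Fintype V] (K : AbstractSimplicialComplex V) (p : V)
      (α : BallClass s d), p ∈ verticesOfType K α → f V K p = g α := by
  classical
  have h : ∀ α : BallClass s d, ∃ x : ℝ, ∀ {V : Type u} [Fintype V]
      (K : AbstractSimplicialComplex V) (p : V), p ∈ verticesOfType K α → f V K p = x := by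
    intro α
    by_cases hα : ∃ (W : Type u) (_ : Fintype W) (L : AbstractSimplicialComplex W) (q : W),
      q ∈ verticesOfType L α
    · obtain ⟨W, _, L, q, B, rfl, hB⟩ := hα
      refine ⟨f W L q, fun {V} _ K p ⟨A, hA, hp⟩ => hf.eq_of_rootedIso ?_⟩
      have hAB : RootedIso A.complex A.root B.complex B.root := Quotient.exact hA
      exact (RootedIso.trans hp hAB).trans hB.symm
    -- A class without any representative vertex imposes no condition, so `0` is an arbitrary
    -- choice.
    · exact ⟨0, fun {V} _ K p hp => (hα ⟨V, inferInstance, K, p, hp⟩).elim⟩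
  choose g hg using h
  exact ⟨g, fun K p α hp => hg α K p hp⟩

theorem IsLocalFun.exists_le (hf : IsLocalFun s f) (d : ℕ) :
    ∃ C : ℝ, 0 ≤ C ∧ ∀ {V : Type u} [Fintype V] (K : AbstractSimplicialComplex V) (p : V),
      DegreeLE d K → f V K p ≤ C := by
  obtain ⟨g, hg⟩ := hf.exists_ballClass_fun d
  let _ := Fintype.ofFinite (BallClass s d)
  refine ⟨∑ α, |g α|, Finset.sum_nonneg fun _ _ => abs_nonneg _, fun {V} _ K p hK => ?_⟩
  obtain ⟨α, hα⟩ := exists_mem_verticesOfType hK s p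
  rw [hg K p α hα]
  exact (le_abs_self _).trans
    (Finset.single_le_sum (f := fun α => |g α|) (fun _ _ => abs_nonneg _) (Finset.mem_univ α))

/-- The sum of a local function over the vertices is a linear combination of the numbers of
vertices of the various types. -/
theorem IsLocalFun.exists_sum_eq (hf : IsLocalFun s f) (d : ℕ) :
    ∃ c : AllBalls d →₀ ℝ, ∀ {V : Type u} [Fintype V] (K : AbstractSimplicialComplex V),
      DegreeLE d K → ∑ p, f V K p =
        Nat.card V * Finsupp.linearCombination ℝ (ballProb K) c := by
  classical
  -- The enumerated balls have radius at least `1`; enlarging the radius preserves locality.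
  replace hf : IsLocalFun (max s 1) f := hf.mono (le_max_left s 1)
  obtain ⟨g, hg⟩ := hf.exists_ballClass_fun d
  let _ := Fintype.ofFinite (BallClass (max s 1) d)
  refine ⟨∑ α : BallClass (max s 1) d, Finsupp.single (AllBalls.mk (le_max_right s 1) α) (g α), fun {V} _ K hK => ?_⟩
  choose τ hτ using fun p => exists_mem_verticesOfType hK (max s 1) p
  rw [map_sum, Finset.mul_sum, ← Finset.sum_fiberwise Finset.univ τ]
  refine Finset.sum_congr rfl fun α _ => ?_
  rw [Finsupp.linearCombination_single, ballProb_mk, samplingProb, smul_eq_mul]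
  have h1 : ∀ p ∈ Finset.univ.filter (fun p => τ p = α), f V K p = g α := by
    intro p hp
    rw [Finset.mem_filter] at hp
    exact hg K p α (hp.2 ▸ hτ p)
  have h2 : verticesOfType K α = (Finset.univ.filter (fun p => τ p = α) : Finset V) := by
    ext p
    simp only [Finset.coe_filter, Finset.mem_univ, true_and, Set.mem_ofPred_eq]
    exact ⟨fun hp => eq_of_mem_verticesOfType (hτ p) hp, fun hp => hp ▸ hτ p⟩
  rw [Finset.sum_congr rfl h1, Finset.sum_const, h2, Set.ncard_coe_finset, nsmul_eq_mul]
  rcases isEmpty_or_nonempty V with hV | hV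
  · simp
  · have : (Nat.card V : ℝ) ≠ 0 := by
      exact_mod_cast Nat.card_pos.ne'
    field_simp

end LocalFunctions

/-! ### Betti numbers as ranks of local integer kernels -/

section Cochains

section Vanishing

variable {V : Type u} (K : AbstractSimplicialComplex V) (q : ℕ)

/-- A vertex of a `q`-simplex has the `q` other vertices as neighbors. -/
theorem cochains_eq_bot {d : ℕ} (hK : DegreeLE d K) (hq : d < q) : cochains K q = ⊥ := by
  classical
  rw [eq_bot_iff]
  intro f hf
  refine funext fun a => hf.1 a fun ha => ?_
  have hsub : (fun j : Fin q => a j.succ) '' Set.univ ⊆ (skeleton K).neighborSet (a 0) := by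
    rintro _ ⟨j, -, rfl⟩
    have := ha.edist_le_one 0 j.succ
    rw [SimpleGraph.edist_le_one_iff_adj_or_eq] at this
    exact this.resolve_right fun h => (Fin.succ_ne_zero j).symm (ha.1 h)
  have hinj : Function.Injective fun j : Fin q => a j.succ :=
    ha.1.comp (Fin.succ_injective q)
  have h := (Set.encard_le_encard hsub).trans (hK (a 0))
  rw [hinj.injOn.encard_image, Set.encard_univ, ENat.card_eq_coe_fintype_card,
    Fintype.card_fin] at h
  exact hq.not_ge (by exact_mod_cast h)

theorem betti_eq_zero {d : ℕ} (hK : DegreeLE d K) (hq : d < q + 1) : betti K (q + 1) = 0 := by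
  have h := cochains_eq_bot K (q + 1) hK hq
  have : Subsingleton (cochains K (q + 1)) := by
    rw [h]
    infer_instance
  rw [betti, Module.finrank_zero_of_subsingleton, Module.finrank_zero_of_subsingleton]
  rfl

end Vanishing

/-- The (unnormalized) antisymmetrization of functions of ordered `q`-simplices. -/
noncomputable def antisymKernel (q : ℕ) : KernelFamily.{u} q q :=
  simplexKernel (ι := Equiv.Perm (Fin (q + 1))) (fun π => (Equiv.Perm.sign π : ℤ)) fun π => π

/-- The coboundary operator on all functions of `(q + 1)`-tuples of vertices. -/
noncomputable def coboundaryKernel (q : ℕ) : KernelFamily.{u} (q + 1) q :=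
  simplexKernel (ι := Fin (q + 2)) (fun j => (-1) ^ (j : ℕ)) fun j => j.succAbove

variable {V : Type u} [Fintype V] (K : AbstractSimplicialComplex V) (q : ℕ)

theorem antisymKernel_mulVec_mem (f : (Fin (q + 1) → V) → ℝ) :
    (antisymKernel q V K).mulVec f ∈ cochains K q := by
  classical
  refine ⟨fun a ha => ?_, fun π a => ?_⟩
  · rw [antisymKernel, simplexKernel_mulVec, if_neg ha]
  · rw [antisymKernel, simplexKernel_mulVec, simplexKernel_mulVec]
    by_cases ha : IsOrderedSimplex K a
    · rw [if_pos ha, if_pos (ha.comp_perm π), Finset.mul_sum,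
        ← Equiv.sum_comp (Equiv.mulLeft π) fun ρ => ((Equiv.Perm.sign π : ℤ) : ℝ) *
          (((Equiv.Perm.sign ρ : ℤ) : ℝ) * f (a ∘ ρ))]
      refine Finset.sum_congr rfl fun ρ _ => ?_
      have h : ((Equiv.Perm.sign π : ℤ) : ℝ) * ((Equiv.Perm.sign π : ℤ) : ℝ) = 1 := by
        rw [← Int.cast_mul, ← Units.val_mul, Int.units_mul_self, Units.val_one, Int.cast_one]
      rw [Equiv.coe_mulLeft, Equiv.Perm.sign_mul, Units.val_mul, Int.cast_mul, ← mul_assoc,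
        ← mul_assoc, h, one_mul, Function.comp_assoc, Equiv.Perm.coe_mul]
    · rw [if_neg ha, if_neg fun h => ha ((isOrderedSimplex_comp_perm_iff π).1 h), mul_zero]

theorem antisymKernel_mulVec_of_mem {f : (Fin (q + 1) → V) → ℝ} (hf : f ∈ cochains K q) :
    (antisymKernel q V K).mulVec f = ((q + 1).factorial : ℝ) • f := by
  classical
  ext a
  rw [antisymKernel, simplexKernel_mulVec]
  split_ifs with ha
  · have h : ∀ π : Equiv.Perm (Fin (q + 1)),
        (((Equiv.Perm.sign π : ℤ)) : ℝ) * f (a ∘ π) = f a := by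
      intro π
      rw [hf.2, ← mul_assoc]
      have h : ((Equiv.Perm.sign π : ℤ) : ℝ) * ((Equiv.Perm.sign π : ℤ) : ℝ) = 1 := by
        rw [← Int.cast_mul, ← Units.val_mul, Int.units_mul_self, Units.val_one, Int.cast_one]
      rw [h, one_mul]
    rw [Finset.sum_congr rfl fun π _ => h π]
    simp [Fintype.card_perm]
  · simp [hf.1 a ha]

/-- The kernel is `(q + 1)!` times a projection onto the cochains; leaving out the normalization
keeps it integral. -/
theorem range_antisymKernel :
    LinearMap.range (antisymKernel q V K).mulVecLin = cochains K q := by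
  apply le_antisymm
  · rintro _ ⟨f, rfl⟩
    exact antisymKernel_mulVec_mem K q f
  · intro f hf
    refine ⟨((q + 1).factorial : ℝ)⁻¹ • f, ?_⟩
    rw [Matrix.mulVecLin_apply, Matrix.mulVec_smul, antisymKernel_mulVec_of_mem K q hf,
      inv_smul_smul₀]
    exact_mod_cast (q + 1).factorial_ne_zero

theorem coboundaryKernel_mulVec (f : (Fin (q + 1) → V) → ℝ) :
    (coboundaryKernel q V K).mulVec f = coboundaryFun K q f := by
  classical
  ext a
  rw [coboundaryKernel, simplexKernel_mulVec, coboundaryFun]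
  split_ifs
  · push_cast
    rfl
  · rfl

theorem finrank_cochains :
    Module.finrank ℝ (cochains K q) = (antisymKernel q V K).rank := by
  rw [Matrix.rank, range_antisymKernel]

theorem finrank_range_coboundary :
    Module.finrank ℝ (LinearMap.range (coboundary K q)) =
      (coboundaryKernel q V K * antisymKernel q V K).rank := by
  rw [Matrix.rank, Matrix.mulVecLin_mul, LinearMap.range_comp, range_antisymKernel,
    ← Submodule.finrank_map_subtype_eq]
  suffices h : (LinearMap.range (coboundary K q)).map (cochains K (q + 1)).subtype =
      (cochains K q).map (coboundaryKernel q V K).mulVecLin by rw [h]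
  ext f
  constructor
  · rintro ⟨_, ⟨g, rfl⟩, rfl⟩
    exact ⟨g, g.2, coboundaryKernel_mulVec K q g⟩
  · rintro ⟨g, hg, rfl⟩
    exact ⟨_, ⟨⟨g, hg⟩, rfl⟩, (coboundaryKernel_mulVec K q g).symm⟩

theorem betti_succ_eq_rank : (betti K (q + 1) : ℝ) =
    ((antisymKernel (q + 1) V K).rank : ℝ) -
      ((coboundaryKernel (q + 1) V K * antisymKernel (q + 1) V K).rank : ℝ) -
      ((coboundaryKernel q V K * antisymKernel q V K).rank : ℝ) := by
  have h := LinearMap.finrank_range_add_finrank_ker (coboundary K (q + 1))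
  rw [finrank_cochains, finrank_range_coboundary] at h
  rw [betti, finrank_range_coboundary, ← h]
  push_cast
  ring

end Cochains

/-! ### Approximation by sampling probabilities and its consequences -/

section Approximation

/-- The parameter `Φ`, divided by the number of vertices, is uniformly approximated by linear
combinations of sampling probabilities. -/
def IsApproximable (d : ℕ) (Φ : ∀ (V : Type u) [Fintype V], AbstractSimplicialComplex V → ℝ) :
    Prop :=
  ∀ η : ℝ, 0 < η → ∃ c : AllBalls d →₀ ℝ, ∀ (V : Type u) [Fintype V]
    (K : AbstractSimplicialComplex V), DegreeLE d K →
      |Φ V K - Nat.card V * Finsupp.linearCombination ℝ (ballProb K) c| ≤ η * Nat.card V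

variable {d : ℕ}

theorem IsApproximable.sub {Φ Ψ : ∀ (V : Type u) [Fintype V], AbstractSimplicialComplex V → ℝ}
    (hΦ : IsApproximable d Φ) (hΨ : IsApproximable d Ψ) :
    IsApproximable d (fun V _ K => Φ V K - Ψ V K) := by
  intro η hη
  obtain ⟨c, hc⟩ := hΦ (η / 2) (half_pos hη)
  obtain ⟨c', hc'⟩ := hΨ (η / 2) (half_pos hη)
  refine ⟨c - c', fun V _ K hK => ?_⟩
  rw [map_sub]
  have h1 := abs_le.1 (hc V K hK)
  have h2 := abs_le.1 (hc' V K hK)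
  rw [abs_le]
  constructor <;> linarith [h1.1, h1.2, h2.1, h2.2]

theorem IsLocalKernel.isApproximable_trace {m s : ℕ} {X : KernelFamily.{u} m m}
    (hX : IsLocalKernel s X) : ∃ c : AllBalls d →₀ ℝ, ∀ (V : Type u) [Fintype V]
      (K : AbstractSimplicialComplex V), DegreeLE d K →
        (X V K).trace = Nat.card V * Finsupp.linearCombination ℝ (ballProb K) c := by
  obtain ⟨c, hc⟩ := hX.isLocalFun_trace.exists_sum_eq d
  refine ⟨c, fun V _ K hK => ?_⟩
  rw [← hc K hK, sum_sumAt]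
  rfl

theorem IsLocalKernel.exists_trace_le {m s : ℕ} {X : KernelFamily.{u} m m}
    (hX : IsLocalKernel s X) (d : ℕ) : ∃ C : ℝ, 0 ≤ C ∧ ∀ (V : Type u) [Fintype V]
      (K : AbstractSimplicialComplex V), DegreeLE d K → (X V K).trace ≤ C * Nat.card V := by
  obtain ⟨C, hC, h⟩ := hX.isLocalFun_trace.exists_le d
  refine ⟨C, hC, fun V _ K hK => ?_⟩
  have h1 := Finset.sum_le_sum fun p (_ : p ∈ Finset.univ) => h K p hK
  rw [sum_sumAt, Finset.sum_const, nsmul_eq_mul, Finset.card_univ, mul_comm,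
    ← Nat.card_eq_fintype_card] at h1
  exact h1

theorem IsLocalKernel.exists_rowSum_le {m n s : ℕ} {X : KernelFamily.{u} m n}
    (hX : IsLocalKernel s X) (d : ℕ) : ∃ C : ℝ, 1 ≤ C ∧ ∀ (V : Type u) [Fintype V]
      (K : AbstractSimplicialComplex V), DegreeLE d K → ∀ a, ∑ b, |X V K a b| ≤ C := by
  obtain ⟨C, hC, h⟩ := hX.isLocalFun_rowSum.exists_le d
  refine ⟨C + 1, by linarith, fun V _ K hK a => ?_⟩
  have h1 := le_sumAt (φ := fun a => ∑ b, |X V K a b|)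
    (fun a => Finset.sum_nonneg fun b _ => abs_nonneg _) a
  linarith [h K (a 0) hK]

/-- Ranks of local integer kernels are approximable. -/
theorem IsLocalKernel.isApproximable_rank {m n s : ℕ} {X : KernelFamily.{u} m n}
    (hX : IsLocalKernel s X) (hint : ∀ (V : Type u) [Fintype V] (K : AbstractSimplicialComplex V),
      ∃ N : Matrix (Fin (m + 1) → V) (Fin (n + 1) → V) ℤ, X V K = N.map (Int.castRingHom ℝ)) :
    IsApproximable d (fun V _ K => ((X V K).rank : ℝ)) := by
  intro η hη
  have hA := hX.transpose.mul hX
  obtain ⟨C, hC, htr⟩ := hA.exists_trace_le d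
  obtain ⟨Λ, hΛ, hrow⟩ := hA.exists_rowSum_le d
  -- The error gets multiplied by a trace of size at most `C |V|`; the `+ 1` allows for `C = 0`.
  obtain ⟨k, hk⟩ := exists_abs_rank_sub_trace_le Λ hΛ (η / (C + 1)) (by positivity)
  obtain ⟨t, ht⟩ := hA.rangeApprox Λ⁻¹ k
  obtain ⟨c, hc⟩ := ht.isApproximable_trace (d := d)
  refine ⟨c, fun V _ K hK => ?_⟩
  obtain ⟨N, hN⟩ := hint V K
  rw [← hc V K hK]
  refine (hk (X V K) N hN (hrow V K hK)).trans ?_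
  calc η / (C + 1) * ((X V K).transpose * X V K).trace
      ≤ η / (C + 1) * (C * Nat.card V) := by gcongr; exact htr V K hK
    _ = (C / (C + 1)) * (η * Nat.card V) := by ring
    _ ≤ 1 * (η * Nat.card V) := by
      gcongr
      rw [div_le_one (by linarith)]
      linarith
    _ = η * Nat.card V := one_mul _

theorem isApproximable_rank_antisymKernel (q : ℕ) :
    IsApproximable.{u} d (fun V _ K => ((antisymKernel q V K).rank : ℝ)) :=
  IsLocalKernel.isApproximable_rank (isLocalKernel_simplexKernel _ _) (simplexKernel_eq_map _ _)

theorem isApproximable_rank_coboundaryKernel (q : ℕ) :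
    IsApproximable.{u} d
      (fun V _ K => ((coboundaryKernel q V K * antisymKernel q V K).rank : ℝ)) := by
  refine IsLocalKernel.isApproximable_rank
    ((isLocalKernel_simplexKernel _ _).mul (isLocalKernel_simplexKernel _ _)) fun V _ K => ?_
  obtain ⟨N, hN⟩ := simplexKernel_eq_map (fun j : Fin (q + 2) => (-1) ^ (j : ℕ))
    (fun j => j.succAbove) V K
  obtain ⟨N', hN'⟩ := simplexKernel_eq_map
    (fun π : Equiv.Perm (Fin (q + 1)) => (Equiv.Perm.sign π : ℤ)) (fun π => π) V K
  exact ⟨N * N', by rw [Matrix.map_mul, ← hN, ← hN']; rfl⟩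

theorem isApproximable_betti (q : ℕ) :
    IsApproximable.{u} d (fun V _ K => (betti K (q + 1) : ℝ)) := by
  have h := ((isApproximable_rank_antisymKernel.{u} (d := d) (q + 1)).sub
    (isApproximable_rank_coboundaryKernel (q + 1))).sub (isApproximable_rank_coboundaryKernel q)
  simpa only [betti_succ_eq_rank] using h

theorem abs_div_sub_le {x n y η : ℝ} (hn : 0 < n) (h : |x - n * y| ≤ η * n) :
    |x / n - y| ≤ η := by
  have : x / n - y = (x - n * y) / n := by field_simp
  rwa [this, abs_div, abs_of_pos hn, div_le_iff₀ hn]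

theorem IsApproximable.exists_tendsto
    {Φ : ∀ (V : Type u) [Fintype V], AbstractSimplicialComplex V → ℝ} (hΦ : IsApproximable d Φ)
    {V : ℕ → Type u} [∀ n, Fintype (V n)] {K : ∀ n, AbstractSimplicialComplex (V n)}
    (hK : ∀ n, DegreeLE d (K n)) (hconv : IsConvergent d K) :
    ∃ l : ℝ, Tendsto (fun n => Φ (V n) (K n) / (Nat.card (V n) : ℝ)) atTop (𝓝 l) := by
  refine cauchySeq_tendsto_of_complete (Metric.cauchySeq_iff'.2 fun ε hε => ?_)
  obtain ⟨c, hc⟩ := hΦ (ε / 4) (by positivity)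
  obtain ⟨l, hl⟩ : ∃ l : ℝ, Tendsto
      (fun n => Finsupp.linearCombination ℝ (ballProb (K n)) c) atTop (𝓝 l) := by
    choose l hl using fun α : AllBalls d => hconv.2 α.1.1 α.1.2 α.2
    refine ⟨Finsupp.linearCombination ℝ l c, ?_⟩
    simp only [Finsupp.linearCombination_apply, Finsupp.sum]
    exact tendsto_finsetSum _ fun α _ => (hl α).const_smul (c α)
  obtain ⟨N₁, hN₁⟩ := Metric.cauchySeq_iff.1 hl.cauchySeq (ε / 4) (by positivity)
  obtain ⟨N₂, hN₂⟩ := eventually_atTop.1 (hconv.1.eventually_gt_atTop 0)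
  have key : ∀ n, N₂ ≤ n → |Φ (V n) (K n) / (Nat.card (V n) : ℝ) -
      Finsupp.linearCombination ℝ (ballProb (K n)) c| ≤ ε / 4 := fun n hn =>
    abs_div_sub_le (by exact_mod_cast hN₂ n hn) (hc _ _ (hK n))
  refine ⟨max N₁ N₂, fun n hn => ?_⟩
  have h1 := abs_le.1 (key n ((le_max_right _ _).trans hn))
  have h2 := abs_le.1 (key (max N₁ N₂) (le_max_right _ _))
  have h3 := hN₁ n ((le_max_left _ _).trans hn) (max N₁ N₂) (le_max_left _ _)
  rw [Real.dist_eq, abs_lt] at h3 ⊢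
  constructor <;> linarith [h1.1, h1.2, h2.1, h2.2, h3.1, h3.2]

/-- A single term is at most the whole series, whose terms are nonnegative and dominated by a
geometric series. -/
theorem abs_ballProb_sub_le (enum : ℕ ≃ AllBalls d) {V W : Type u} [Finite V] [Finite W]
    (K : AbstractSimplicialComplex V) (L : AbstractSimplicialComplex W) (α : AllBalls d) :
    |ballProb K α - ballProb L α| ≤ 2 ^ (enum.symm α + 1) * samplingDist enum K L := by
  have hsum : Summable fun k : ℕ =>
      1 / 2 ^ (k + 1) * |samplingProb K (enum k).2 - samplingProb L (enum k).2| := by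
    refine Summable.of_nonneg_of_le (fun k => by positivity) (fun k => ?_)
      ((summable_nat_add_iff 1).2 summable_geometric_two)
    rw [← one_div_pow]
    refine mul_le_of_le_one_right (by positivity) ?_
    rw [abs_le]
    constructor <;> linarith [samplingProb_nonneg K (enum k).2, samplingProb_le_one K (enum k).2,
      samplingProb_nonneg L (enum k).2, samplingProb_le_one L (enum k).2]
  have h := hsum.le_tsum (enum.symm α) fun k _ => by positivity
  rw [Equiv.apply_symm_apply] at h
  change 1 / 2 ^ (enum.symm α + 1) * |ballProb K α - ballProb L α| ≤ samplingDist enum K L at h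
  rwa [one_div, inv_mul_le_iff₀ (by positivity)] at h

theorem IsApproximable.exists_samplingDist
    {Φ : ∀ (V : Type u) [Fintype V], AbstractSimplicialComplex V → ℝ} (hΦ : IsApproximable d Φ)
    (enum : ℕ ≃ AllBalls d) {ε : ℝ} (hε : 0 < ε) :
    ∃ δ : ℝ, 0 < δ ∧ ∀ (V W : Type u) [Fintype V] [Fintype W] [Nonempty V] [Nonempty W]
      (K : AbstractSimplicialComplex V) (L : AbstractSimplicialComplex W),
      DegreeLE d K → DegreeLE d L → samplingDist enum K L < δ →
        |Φ V K / (Nat.card V : ℝ) - Φ W L / (Nat.card W : ℝ)| ≤ ε := by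
  obtain ⟨c, hc⟩ := hΦ (ε / 3) (by positivity)
  -- `S` is a Lipschitz constant of the linear combination with respect to the sampling distance.
  set S : ℝ := ∑ α ∈ c.support, |c α| * 2 ^ (enum.symm α + 1) with hS
  have hS0 : 0 ≤ S := Finset.sum_nonneg fun _ _ => by positivity
  refine ⟨ε / 3 / (S + 1), by positivity, fun V W _ _ _ _ K L hK hL hKL => ?_⟩
  have h1 := abs_le.1 (abs_div_sub_le (by exact_mod_cast Nat.card_pos) (hc V K hK))
  have h2 := abs_le.1 (abs_div_sub_le (by exact_mod_cast Nat.card_pos) (hc W L hL))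
  have h3 : |Finsupp.linearCombination ℝ (ballProb K) c -
      Finsupp.linearCombination ℝ (ballProb L) c| ≤ ε / 3 := by
    simp only [Finsupp.linearCombination_apply, Finsupp.sum, smul_eq_mul]
    rw [← Finset.sum_sub_distrib]
    calc |∑ α ∈ c.support, (c α * ballProb K α - c α * ballProb L α)|
        ≤ ∑ α ∈ c.support, |c α * ballProb K α - c α * ballProb L α| :=
          Finset.abs_sum_le_sum_abs _ _
      _ ≤ ∑ α ∈ c.support, |c α| * 2 ^ (enum.symm α + 1) * (ε / 3 / (S + 1)) := by
          refine Finset.sum_le_sum fun α _ => ?_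
          rw [← mul_sub, abs_mul, mul_assoc]
          gcongr
          refine (abs_ballProb_sub_le enum K L α).trans ?_
          gcongr
      _ = S * (ε / 3 / (S + 1)) := by rw [← Finset.sum_mul]
      _ = S / (S + 1) * (ε / 3) := by ring
      _ ≤ 1 * (ε / 3) := by
          gcongr
          rw [div_le_one (by linarith)]
          linarith
      _ = ε / 3 := one_mul _
  have h3 := abs_le.1 h3
  rw [abs_le]
  constructor <;> linarith [h1.1, h1.2, h2.1, h2.2, h3.1, h3.2]

end Approximation

end BoundedComplex

open BoundedComplex
theorem lemma6p1 (d : ℕ) (hd : 2 ≤ d) :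
    (∀ (V : ℕ → Type u) [∀ n, Finite (V n)] (K : ∀ n, AbstractSimplicialComplex (V n)),
      (∀ n, DegreeLE d (K n)) → IsConvergent d K →
      ∀ i : ℕ, 1 ≤ i →
        ∃ l : ℝ, Tendsto (fun n => (betti (K n) i : ℝ) / (Nat.card (V n) : ℝ)) atTop (𝓝 l)) ∧
    (∀ (enum : ℕ ≃ AllBalls d) (ε : ℝ), 0 < ε →
      ∃ δ : ℝ, 0 < δ ∧
        ∀ (V W : Type u) [Finite V] [Finite W] [Nonempty V] [Nonempty W]
          (K : AbstractSimplicialComplex V) (L : AbstractSimplicialComplex W),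
          DegreeLE d K → DegreeLE d L → samplingDist enum K L < δ →
          ∀ i : ℕ, 1 ≤ i →
            |(betti K i : ℝ) / (Nat.card V : ℝ) - (betti L i : ℝ) / (Nat.card W : ℝ)| ≤ ε) := by
  refine ⟨fun V _ K hK hconv i hi => ?_, fun enum ε hε => ?_⟩
  · obtain ⟨q, rfl⟩ := Nat.exists_eq_add_of_le' hi
    have := fun n => Fintype.ofFinite (V n)
    exact (isApproximable_betti (d := d) q).exists_tendsto hK hconv
  · choose δ hδ h using fun q => (isApproximable_betti.{u} (d := d) q).exists_samplingDist enum hε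
    -- Betti numbers of degree above `d` vanish, so a minimum over finitely many `δ q` serves all
    -- degrees.
    have hne : (Finset.range (d + 1)).Nonempty := ⟨0, by simp⟩
    refine ⟨(Finset.range (d + 1)).inf' hne δ, (Finset.lt_inf'_iff hne).2 fun q _ => hδ q,
      fun V W _ _ _ _ K L hK hL hKL i hi => ?_⟩
    obtain ⟨q, rfl⟩ := Nat.exists_eq_add_of_le' hi
    have := Fintype.ofFinite V
    have := Fintype.ofFinite W
    by_cases hq : d < q + 1
    · rw [betti_eq_zero K q hK hq, betti_eq_zero L q hL hq]
      simpa using hε.le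
    · exact h q V W K L hK hL
        (hKL.trans_le (Finset.inf'_le _ (Finset.mem_range.2 (by omega))))
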